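/- A \emph{rooted tree} is a finite tree whose edges are all directed away from a root. A \emph{dominance drawing} of a directed acyclic graph places its vertices at distinct points of the plane so that, for all vertices $u,v$, there is a directed path (possibly of length $0$) from $u$ to $v$ if and only if both coordinates of $v$ are greater than or equal to the corresponding coordinates of $u$; it is \emph{planar} if, with edges drawn as straight line segments, no edge passes through a vertex other than its ends and two different edges meet only at common ends. The \emph{permutation defined by a dominance drawing} lists the points from left to right (points with equal $x$-coordinate from bottom to top) and records their order from bottom to top (points with equal $y$-coordinate being ordered from left to right). A permutation $\pi$ is a \emph{pattern} of $\sigma$ if some subsequence of $\sigma$ has the same relative order as $\pi$; $\sigma$ \emph{avoids} $\pi$ if $\pi$ is not a pattern of $\sigma$. An \emph{$S_m(213)$-superpattern} is a permutation that has every $213$-avoiding permutation of length $m$ as a pattern. The \emph{plot} of a permutation $\sigma$ of length $k$ is the point set $\{(i,\sigma_i) : 1\le i\le k\}$. \textbf{Theorem.} The permutation defined by any dominance drawing of a rooted tree avoids $213$. Moreover, there exist finite point sets $U_n\subset\mathbb{R}^2$ ($n\ge 1$) such that every rooted tree with $n$ vertices has a planar dominance drawing with all its vertices in $U_n$, and $|U_n|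 = n^2/4+\Theta(n)$, that is, there are constants $c,C>0$ with $n^2/4+cn\le |U_n|\le n^2/4+Cn$ for all $n\ge 1$. In addition, the sets can be chosen so that each $U_n$ is the plot of a permutation whose first element is its smallest and whose remaining elements are order-isomorphic to an $S_{n-1}(213)$-superpattern. -/

import Mathlib

universe u

/-- A rooted (directed) tree: an orientation of an undirected tree (no loops, no pair of opposite
edges) in which every vertex can be reached from some vertex, the root. -/
def IsRootedTree {V : Type*} (G : Digraph V) : Prop :=
  (∀ u v, G.Adj u v → ¬ G.Adj v u) ∧
  G.toSimpleGraphInclusive.IsTree ∧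
  ∃ r : V, ∀ v : V, Relation.ReflTransGen G.Adj r v

/-- `p` places the vertices of `G` at distinct points of the plane so that reachability is the same
relation as dominance (`≤` on `ℝ × ℝ` is the coordinatewise order). -/
def IsDominanceDrawing {V : Type*} (G : Digraph V) (p : V → ℝ × ℝ) : Prop :=
  Function.Injective p ∧ ∀ u v, Relation.ReflTransGen G.Adj u v ↔ p u ≤ p v

/-- The straight-line drawing of `G` with vertex placement `p` is non-crossing: vertices are placed
at distinct points, an edge passes through no vertex but its two ends, and two different edges meet
only in the images of common ends. -/
def IsPlanarDrawing {V : Type*} (G : Digraph V) (p : V → ℝ × ℝ) : Prop :=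
  Function.Injective p ∧
  (∀ u v w, G.Adj u v → p w ∈ segment ℝ (p u) (p v) → w = u ∨ w = v) ∧
  (∀ u v u' v', G.Adj u v → G.Adj u' v' → (u, v) ≠ (u', v') →
    segment ℝ (p u) (p v) ∩ segment ℝ (p u') (p v') ⊆ p '' (({u, v} : Set V) ∩ {u', v'}))

/-- `S` is a universal point set for the planar dominance drawings of rooted trees with `n`
vertices: each such tree has a planar dominance drawing with all its vertices in `S`. -/
def IsUniversalForTrees (n : ℕ) (S : Finset (ℝ × ℝ)) : Prop :=
  ∀ (V : Type u) [Fintype V] (G : Digraph V), Fintype.card V = n → IsRootedTree G →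
    ∃ p : V → ℝ × ℝ, (∀ v, p v ∈ S) ∧ IsDominanceDrawing G p ∧ IsPlanarDrawing G p

/-- `π` is a pattern of `σ`: some subsequence of `σ` is ordered like `π`. -/
def IsPatternOf {m k : ℕ} (π : Equiv.Perm (Fin m)) (σ : Equiv.Perm (Fin k)) : Prop :=
  ∃ l : Fin m ↪o Fin k, ∀ i j, π i < π j ↔ σ (l i) < σ (l j)

/-- The permutation `213` (`102` when the values start from `0`). -/
def perm213 : Equiv.Perm (Fin 3) := Equiv.swap 0 1

/-- `σ` avoids the pattern `213`. -/
def Avoids213 {k : ℕ} (σ : Equiv.Perm (Fin k)) : Prop := ¬ IsPatternOf perm213 σ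

/-- `σ` is an `S_m(213)`-superpattern. -/
def IsSuperpattern213 (m : ℕ) {k : ℕ} (σ : Equiv.Perm (Fin k)) : Prop :=
  ∀ π : Equiv.Perm (Fin m), Avoids213 π → IsPatternOf π σ

/-- The plot of a permutation: the points `(i, σ_i)`, with positions and values starting from
`1`. -/
noncomputable def permPlot {k : ℕ} (σ : Equiv.Perm (Fin k)) : Finset (ℝ × ℝ) :=
  Finset.univ.image fun i : Fin k => (((i : ℕ) : ℝ) + 1, ((σ i : ℕ) : ℝ) + 1)

/-- The permutation whose first element is its smallest and whose remaining elements are ordered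
like `μ`. -/
def prependMin {k : ℕ} (μ : Equiv.Perm (Fin k)) : Equiv.Perm (Fin (k + 1)) :=
  Equiv.Perm.decomposeFin.symm (0, μ)

theorem prependMin_zero {k : ℕ} (μ : Equiv.Perm (Fin k)) : prependMin μ 0 = 0 := by
  simp [prependMin]

theorem prependMin_succ {k : ℕ} (μ : Equiv.Perm (Fin k)) (i : Fin k) :
    prependMin μ i.succ = (μ i).succ := by
  simp [prependMin]

/-- `σ` is the permutation defined by the point placement `p`: the points are listed from left to
right, and `σ` gives their order from bottom to top. Points with equal `x` coordinate are listed
from bottom to top and points with equal `y` coordinate are ordered from left to right, as after a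
small shear that keeps the dominance relation. -/
def IsPermOfDrawing {V : Type*} {n : ℕ} (p : V → ℝ × ℝ) (σ : Equiv.Perm (Fin n)) : Prop :=
  ∃ e : Fin n ≃ V,
    (∀ i j, i < j ↔ toLex (p (e i)) < toLex (p (e j))) ∧
    (∀ i j, σ i < σ j ↔ toLex (p (e i)).swap < toLex (p (e j)).swap)

/-! Two vertices that reach a common vertex are comparable. Hence a dominance drawing of a rooted
tree avoids 213: the elements 2 and 1 would be incomparable ancestors of 3. The same fact makes
every such drawing planar (`IsDominanceDrawing.isPlanarDrawing`). Conversely, a forest order is the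
intersection of two linear orders (`Finset.exists_realizer_of_forest`). Applied to a tree without
its root, this gives a 213-avoiding permutation, which embeds in any superpattern; the root becomes
the first, lowest point (`IsSuperpattern213.isUniversalForTrees`).

A superpattern of size about n²/4 comes from `nestedRows`. By 213-avoidance, the elements not above
the last one increase, so they fit in one row. The others leave free the column of the last element
and that of the lowest one; closing the gap at the latter, they need two columns fewer. The rows
thus have lengths n, n - 2, n - 4, ... Shifting left can create equal columns, but these are
resolved by height, and the lower bound `IsColumnDrawing.le_fst` keeps the shift from going too far.
-/

/-! ### Reachability in rooted trees -/

/-- In a tree, a vertex has only one neighbour that is closer to a given vertex. -/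
theorem SimpleGraph.IsTree.eq_of_adj_of_dist_add_one {V : Type*} {G : SimpleGraph V}
    (hG : G.IsTree) {r u v w : V} (hu : G.Adj u w) (hv : G.Adj v w)
    (hdu : G.dist r w = G.dist r u + 1) (hdv : G.dist r w = G.dist r v + 1) : u = v := by
  classical
  have key : ∀ x, G.Adj x w → G.dist r w = G.dist r x + 1 →
      ∃ p : G.Walk r w, p.IsPath ∧ p.penultimate = x := by
    intro x hx hd
    obtain ⟨p, hp, hl⟩ := (hG.connected r x).exists_path_of_dist
    refine ⟨p.concat hx, hp.concat (fun hw => ?_) hx, by simp⟩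
    have h1 := SimpleGraph.dist_le (p.takeUntil w hw)
    have h2 := p.length_takeUntil_le_length hw
    omega
  obtain ⟨p, hp, rfl⟩ := key u hu hdu
  obtain ⟨q, hq, rfl⟩ := key v hv hdv
  rw [(hG.existsUnique_path r w).unique hp hq]

theorem Digraph.toSimpleGraphInclusive_adj_of_adj {V : Type*} {G : Digraph V}
    (hG : ∀ u v, G.Adj u v → ¬ G.Adj v u) {u v : V} (h : G.Adj u v) :
    G.toSimpleGraphInclusive.Adj u v := by
  rw [Digraph.toSimpleGraphInclusive, SimpleGraph.fromRel_adj]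
  refine ⟨?_, Or.inl h⟩
  rintro rfl
  exact hG _ _ h h

namespace IsRootedTree

variable {V : Type*} {G : Digraph V}

/-- The depth is the distance from the root. An edge back towards the root would have to retrace the
edge by which its tail was reached, against asymmetry. -/
theorem exists_depth (hG : IsRootedTree G) :
    ∃ d : V → ℕ, (∀ u v, G.Adj u v → d v = d u + 1) ∧
      ∀ u v w, G.Adj u w → G.Adj v w → u = v := by
  obtain ⟨hasymm, htree, r, hr⟩ := hG
  have hadj : ∀ {u v}, G.Adj u v → G.toSimpleGraphInclusive.Adj u v := fun h =>
    Digraph.toSimpleGraphInclusive_adj_of_adj hasymm h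
  have hd : ∀ u, Relation.ReflTransGen G.Adj r u → ∀ v, G.Adj u v →
      G.toSimpleGraphInclusive.dist r v = G.toSimpleGraphInclusive.dist r u + 1 := by
    intro u hu
    induction hu with
    | refl =>
      intro v hv
      rw [SimpleGraph.dist_self, SimpleGraph.dist_eq_one_iff_adj.2 (hadj hv)]
    | tail _ hxy ih =>
      intro v hv
      have h1 := ih _ hxy
      rcases htree.dist_eq_dist_add_one_of_adj r (hadj hv) with h | h
      · have := htree.eq_of_adj_of_dist_add_one (hadj hxy) (hadj hv).symm h1 h
        subst this
        exact absurd hv (hasymm _ _ hxy)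
      · exact h
  refine ⟨_, fun u v h => hd u (hr u) v h, fun u v w hu hv => ?_⟩
  exact htree.eq_of_adj_of_dist_add_one (hadj hu) (hadj hv) (hd u (hr u) w hu) (hd v (hr v) w hv)

theorem adj_unique (hG : IsRootedTree G) {u v w : V} (hu : G.Adj u w) (hv : G.Adj v w) : u = v := by
  obtain ⟨d, -, h⟩ := hG.exists_depth
  exact h u v w hu hv

theorem reach_antisymm (hG : IsRootedTree G) {u v : V} (huv : Relation.ReflTransGen G.Adj u v)
    (hvu : Relation.ReflTransGen G.Adj v u) : u = v := by
  obtain ⟨d, hd, -⟩ := hG.exists_depth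
  have key : ∀ {a b}, Relation.ReflTransGen G.Adj a b → a = b ∨ d a < d b := by
    intro a b h
    induction h with
    | refl => exact Or.inl rfl
    | tail _ hbc ih =>
      have := hd _ _ hbc
      rcases ih with rfl | ih
      · right; omega
      · right; omega
  rcases key huv with h | h
  · exact h
  · rcases key hvu with h' | h'
    · exact h'.symm
    · omega

/-- Parents are unique, so the reversed edges form a partial function, whose orbits are chains. -/
theorem reach_total (hG : IsRootedTree G) {u v w : V} (hu : Relation.ReflTransGen G.Adj u w)
    (hv : Relation.ReflTransGen G.Adj v w) :
    Relation.ReflTransGen G.Adj u v ∨ Relation.ReflTransGen G.Adj v u := by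
  have hU : Relator.RightUnique (Function.swap G.Adj) := fun a b c hb hc => hG.adj_unique hb hc
  exact ((Relation.ReflTransGen.total_of_right_unique hU
    (Relation.reflTransGen_swap.2 hu) (Relation.reflTransGen_swap.2 hv)).imp
    Relation.reflTransGen_swap.1 Relation.reflTransGen_swap.1).symm

theorem eq_or_reach_of_adj (hG : IsRootedTree G) {u v w : V} (huv : G.Adj u v)
    (hw : Relation.ReflTransGen G.Adj w v) : w = v ∨ Relation.ReflTransGen G.Adj w u := by
  rcases Relation.ReflTransGen.cases_tail hw with h | ⟨x, hx, hxv⟩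
  · exact Or.inl h.symm
  · rw [hG.adj_unique huv hxv]
    exact Or.inr hx

end IsRootedTree

/-! ### Dominance drawings: 213-avoidance and planarity -/

theorem IsDominanceDrawing.avoids213 {V : Type*} {G : Digraph V} {p : V → ℝ × ℝ} {n : ℕ}
    {σ : Equiv.Perm (Fin n)} (hG : IsRootedTree G) (hp : IsDominanceDrawing G p)
    (hσ : IsPermOfDrawing p σ) : Avoids213 σ := by
  rintro ⟨l, hl⟩
  obtain ⟨e, hx, hy⟩ := hσ
  have hle : ∀ i j, i < j → σ i < σ j → Relation.ReflTransGen G.Adj (e i) (e j) := by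
    intro i j hij hσij
    rw [hp.2]
    have h1 := (hx i j).1 hij
    have h2 := (hy i j).1 hσij
    rw [Prod.Lex.toLex_lt_toLex] at h1 h2
    simp only [Prod.fst_swap, Prod.snd_swap] at h2
    constructor
    · rcases h1 with h | h
      exacts [h.le, h.1.le]
    · rcases h2 with h | h
      exacts [h.le, h.1.le]
  have hnle : ∀ i j, Relation.ReflTransGen G.Adj (e i) (e j) → i ≤ j ∧ σ i ≤ σ j := by
    intro i j h
    rw [hp.2] at h
    constructor
    · by_contra! hc
      have h1 := (hx j i).1 hc
      exact absurd h1 (not_lt.2 (Prod.Lex.toLex_mono h))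
    · by_contra! hc
      have h1 := (hy j i).1 hc
      exact absurd h1 (not_lt.2 (Prod.Lex.toLex_mono (Prod.swap_le_swap.2 h)))
  have h10 : σ (l 1) < σ (l 0) := (hl 1 0).1 (by decide)
  have h02 : σ (l 0) < σ (l 2) := (hl 0 2).1 (by decide)
  have l01 : l 0 < l 1 := l.lt_iff_lt.2 (by decide)
  have l12 : l 1 < l 2 := l.lt_iff_lt.2 (by decide)
  rcases hG.reach_total (hle _ _ (l01.trans l12) h02) (hle _ _ l12 (h10.trans h02)) with h | h
  · exact absurd (hnle _ _ h).2 (not_le.2 h10)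
  · exact absurd (hnle _ _ h).1 (not_le.2 l01)

/-- Dominance drawings of rooted trees are planar. -/
theorem IsDominanceDrawing.isPlanarDrawing {V : Type*} {G : Digraph V} {p : V → ℝ × ℝ}
    (hG : IsRootedTree G) (hp : IsDominanceDrawing G p) : IsPlanarDrawing G p := by
  obtain ⟨hinj, hdom⟩ := hp
  -- An edge lies in the box spanned by its ends, so most crossings are excluded by comparing
  -- corners.
  have hseg : ∀ {u v z}, G.Adj u v → z ∈ segment ℝ (p u) (p v) → p u ≤ z ∧ z ≤ p v := by
    intro u v z huv hz
    have := segment_subset_Icc ((hdom u v).1 (.single huv)) hz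
    exact ⟨this.1, this.2⟩
  refine ⟨hinj, ?_, ?_⟩
  · intro u v w huv hw
    obtain ⟨h1, h2⟩ := hseg huv hw
    rcases hG.eq_or_reach_of_adj huv ((hdom _ _).2 h2) with h | h
    · exact Or.inr h
    · exact Or.inl (hG.reach_antisymm h ((hdom _ _).2 h1))
  · -- if the second edge starts above the end of the first, they meet there
    have habove : ∀ {u v u' v' z}, G.Adj u v → G.Adj u' v' → z ∈ segment ℝ (p u) (p v) →
        z ∈ segment ℝ (p u') (p v') → v ≠ v' → p v ≤ p v' →
        z ∈ p '' (({u, v} : Set V) ∩ {u', v'}) := by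
      intro u v u' v' z h h' hz hz' hne hle
      rcases hG.eq_or_reach_of_adj h' ((hdom _ _).2 hle) with h1 | h1
      · exact absurd h1 hne
      have h2 := (hdom _ _).1 h1
      have e1 : p v = p u' := le_antisymm h2 ((hseg h' hz').1.trans (hseg h hz).2)
      have e2 : p v = z := le_antisymm (h2.trans (hseg h' hz').1) (hseg h hz).2
      have := hinj e1
      subst this
      exact ⟨v, ⟨by simp, by simp⟩, e2⟩
    intro u v u' v' h h' hne z hz
    obtain ⟨hz, hz'⟩ := hz
    have hvv : v ≠ v' := by
      rintro rfl
      exact hne (by rw [hG.adj_unique h h'])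
    by_cases c1 : p v ≤ p v'
    · exact habove h h' hz hz' hvv c1
    by_cases c2 : p v' ≤ p v
    · rw [Set.inter_comm]
      exact habove h' h hz' hz hvv.symm c2
    have hstart : ∀ {u v u' v' z}, G.Adj u v → G.Adj u' v' → z ∈ segment ℝ (p u) (p v) →
        z ∈ segment ℝ (p u') (p v') → ¬ p v ≤ p v' → Relation.ReflTransGen G.Adj u u' → u = u' := by
      intro u v u' v' z h h' hz hz' hc hr
      have h1 : p u' ≤ p v := (hseg h' hz').1.trans (hseg h hz).2
      rcases hG.eq_or_reach_of_adj h ((hdom _ _).2 h1) with h2 | h2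
      · subst h2
        exact absurd ((hdom _ _).1 (.single h')) hc
      · exact hG.reach_antisymm hr h2
    have huu : u = u' := by
      have r1 : Relation.ReflTransGen G.Adj u' v :=
        (hdom _ _).2 ((hseg h' hz').1.trans (hseg h hz).2)
      rcases hG.reach_total (.single h) r1 with hr | hr
      · exact hstart h h' hz hz' c1 hr
      · exact (hstart h' h hz' hz c2 hr).symm
    subst huu
    refine ⟨u, ⟨by simp, by simp⟩, ?_⟩
    rw [segment_eq_image'] at hz hz'
    obtain ⟨s, ⟨hs0, -⟩, rfl⟩ := hz
    obtain ⟨t, ⟨ht0, -⟩, hst⟩ := hz'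
    have hst' : t • (p v' - p u) = s • (p v - p u) := by simpa using hst
    -- Two segments from a common start that meet again are collinear with the same direction, so
    -- their far ends would be comparable.
    have hcmp : ∀ {s t : ℝ} {a b c : ℝ × ℝ}, 0 ≤ t → t ≤ s → 0 < s → a ≤ c →
        t • (c - a) = s • (b - a) → b ≤ c := by
      intro s t a b c ht hts hs hac he
      have h1 := congrArg Prod.fst he
      have h2 := congrArg Prod.snd he
      simp only [Prod.smul_fst, Prod.smul_snd, Prod.fst_sub, Prod.snd_sub, smul_eq_mul] at h1 h2
      obtain ⟨ha1, ha2⟩ := hac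
      constructor
      · by_contra! hc
        nlinarith [mul_le_mul_of_nonneg_right hts (sub_nonneg.2 ha1)]
      · by_contra! hc
        nlinarith [mul_le_mul_of_nonneg_right hts (sub_nonneg.2 ha2)]
    have hv0 : p u ≤ p v := (hdom _ _).1 (.single h)
    have hv0' : p u ≤ p v' := (hdom _ _).1 (.single h')
    rcases le_total t s with hts | hts
    · rcases hs0.eq_or_lt with h0 | h0
      · simp [← h0]
      · exact absurd (hcmp ht0 hts h0 hv0' hst') c1
    · rcases ht0.eq_or_lt with h0 | h0
      · have : s = 0 := le_antisymm (h0 ▸ hts) hs0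
        simp [this]
      · exact absurd (hcmp hs0 hts h0 hv0 hst'.symm) c2

/-! ### Forest orders as intersections of two linear orders -/

/-- A finite partial order in which the elements below any given one form a chain is the
intersection of two linear orders. -/
theorem Finset.exists_realizer_of_forest {V : Type*} [PartialOrder V]
    (htot : ∀ u v w : V, u ≤ w → v ≤ w → u ≤ v ∨ v ≤ u) (s : Finset V) :
    ∃ f g : V → ℕ, Set.InjOn f s ∧ Set.InjOn g s ∧
      ∀ u ∈ s, ∀ v ∈ s, u ≤ v ↔ f u ≤ f v ∧ g u ≤ g v := by
  classical
  induction s using Finset.strongInduction with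
  | H s ih =>
    rcases s.eq_empty_or_nonempty with rfl | hne
    · exact ⟨fun _ => 0, fun _ => 0, by simp, by simp, by simp⟩
    obtain ⟨r, hr⟩ := s.exists_minimal hne
    have hrs : r ∈ s := hr.prop
    have hmin : ∀ v ∈ s, v ≤ r → v = r := fun v hv h => le_antisymm h (hr.le_of_le hv h)
    obtain ⟨fA, gA, hfA, hgA, hA⟩ := ih (s.filter (r < ·))
      (Finset.filter_ssubset.2 ⟨r, hrs, lt_irrefl r⟩)
    obtain ⟨fB, gB, hfB, hgB, hB⟩ := ih (s.filter (¬ r ≤ ·))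
      (Finset.filter_ssubset.2 ⟨r, hrs, not_not.2 le_rfl⟩)
    have bA : ∀ v ∈ s, r < v → fA v ≤ (s.filter (r < ·)).sup fA := fun v hv h =>
      Finset.le_sup (Finset.mem_filter.2 ⟨hv, h⟩)
    have bB : ∀ v ∈ s, ¬ r ≤ v → gB v ≤ (s.filter (¬ r ≤ ·)).sup gB := fun v hv h =>
      Finset.le_sup (f := gB) (Finset.mem_filter.2 ⟨hv, h⟩)
    set M := (s.filter (r < ·)).sup fA
    set N := (s.filter (¬ r ≤ ·)).sup gB
    have tri : ∀ v ∈ s, v = r ∨ r < v ∨ ¬ r ≤ v := by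
      intro v _
      by_cases h : r ≤ v
      · rcases h.eq_or_lt with h | h
        exacts [Or.inl h.symm, Or.inr (Or.inl h)]
      · exact Or.inr (Or.inr h)
    -- With A above the minimal element `r` and B not above it, `f` lists r, A, B and `g` lists B,
    -- r, A; so A and B are in opposite orders. The offsets by `M` and `N` keep the blocks disjoint.
    let f : V → ℕ := fun v => if v = r then 0 else if r ≤ v then 1 + fA v else 2 + M + fB v
    let g : V → ℕ := fun v => if v = r then N + 1 else if r ≤ v then N + 2 + gA v else gB v
    have fr : f r = 0 := if_pos rfl
    have gr : g r = N + 1 := if_pos rfl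
    have f1 : ∀ v, r < v → f v = 1 + fA v := fun v h => by
      simp only [f, if_neg h.ne', if_pos h.le]
    have g1 : ∀ v, r < v → g v = N + 2 + gA v := fun v h => by
      simp only [g, if_neg h.ne', if_pos h.le]
    have f2 : ∀ v, ¬ r ≤ v → f v = 2 + M + fB v := fun v h => by
      have : v ≠ r := fun e => h e.ge
      simp only [f, if_neg h, if_neg this]
    have g2 : ∀ v, ¬ r ≤ v → g v = gB v := fun v h => by
      have : v ≠ r := fun e => h e.ge
      simp only [g, if_neg h, if_neg this]
    have key : ∀ u ∈ s, ∀ v ∈ s, u ≤ v ↔ f u ≤ f v ∧ g u ≤ g v := by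
      intro u hu v hv
      rcases tri u hu with rfl | hu' | hu' <;> rcases tri v hv with rfl | hv' | hv'
      · simp
      · rw [fr, gr, f1 v hv', g1 v hv']
        exact ⟨fun _ => by omega, fun _ => hv'.le⟩
      · have := bB v hv hv'
        rw [fr, gr, f2 v hv', g2 v hv']
        exact ⟨fun h => absurd h hv', fun h => by omega⟩
      · rw [fr, gr, f1 u hu', g1 u hu']
        exact ⟨fun h => absurd h (not_le_of_gt hu'), fun h => by omega⟩
      · rw [f1 u hu', g1 u hu', f1 v hv', g1 v hv',
          hA u (Finset.mem_filter.2 ⟨hu, hu'⟩) v (Finset.mem_filter.2 ⟨hv, hv'⟩)]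
        omega
      · have := bB v hv hv'
        rw [f1 u hu', g1 u hu', f2 v hv', g2 v hv']
        exact ⟨fun h => absurd (hu'.le.trans h) hv', fun h => by omega⟩
      · rw [fr, gr, f2 u hu', g2 u hu']
        exact ⟨fun h => absurd (hmin u hu h).ge hu', fun h => by omega⟩
      · have := bA v hv hv'
        rw [f2 u hu', g2 u hu', f1 v hv', g1 v hv']
        -- Here the forest condition enters: an element below something in A is comparable with `r`,
        -- hence not in B.
        refine ⟨fun h => ?_, fun h => by omega⟩
        rcases htot _ _ _ h hv'.le with h' | h'
        · exact absurd (hmin u hu h').ge hu'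
        · exact absurd h' hu'
      · rw [f2 u hu', g2 u hu', f2 v hv', g2 v hv',
          hB u (Finset.mem_filter.2 ⟨hu, hu'⟩) v (Finset.mem_filter.2 ⟨hv, hv'⟩)]
        omega
    refine ⟨f, g, ?_, ?_, key⟩
    · intro u hu v hv h
      rcases tri u hu with rfl | hu' | hu' <;> rcases tri v hv with rfl | hv' | hv'
      · rfl
      · rw [fr, f1 v hv'] at h; omega
      · rw [fr, f2 v hv'] at h; omega
      · rw [fr, f1 u hu'] at h; omega
      · rw [f1 u hu', f1 v hv'] at h
        exact hfA (by simpa using ⟨hu, hu'⟩) (by simpa using ⟨hv, hv'⟩) (by omega)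
      · have := bA u hu hu'
        rw [f1 u hu', f2 v hv'] at h; omega
      · rw [fr, f2 u hu'] at h; omega
      · have := bA v hv hv'
        rw [f2 u hu', f1 v hv'] at h; omega
      · rw [f2 u hu', f2 v hv'] at h
        exact hfB (by simpa using ⟨hu, hu'⟩) (by simpa using ⟨hv, hv'⟩) (by omega)
    · intro u hu v hv h
      rcases tri u hu with rfl | hu' | hu' <;> rcases tri v hv with rfl | hv' | hv'
      · rfl
      · rw [gr, g1 v hv'] at h; omega
      · have := bB v hv hv'
        rw [gr, g2 v hv'] at h; omega
      · rw [gr, g1 u hu'] at h; omega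
      · rw [g1 u hu', g1 v hv'] at h
        exact hgA (by simpa using ⟨hu, hu'⟩) (by simpa using ⟨hv, hv'⟩) (by omega)
      · have := bB v hv hv'
        rw [g1 u hu', g2 v hv'] at h; omega
      · have := bB u hu hu'
        rw [gr, g2 u hu'] at h; omega
      · have := bB u hu hu'
        rw [g2 u hu', g1 v hv'] at h; omega
      · rw [g2 u hu', g2 v hv'] at h
        exact hgB (by simpa using ⟨hu, hu'⟩) (by simpa using ⟨hv, hv'⟩) (by omega)

theorem IsRootedTree.exists_realizer {V : Type*} [Fintype V] {G : Digraph V} (hG : IsRootedTree G) :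
    ∃ f g : V → ℕ, Function.Injective f ∧ Function.Injective g ∧
      ∀ u v, Relation.ReflTransGen G.Adj u v ↔ f u ≤ f v ∧ g u ≤ g v := by
  let _ : PartialOrder V :=
    { le := Relation.ReflTransGen G.Adj
      le_refl := fun _ => .refl
      le_trans := fun _ _ _ => .trans
      le_antisymm := fun _ _ => hG.reach_antisymm }
  obtain ⟨f, g, hf, hg, h⟩ := Finset.exists_realizer_of_forest (V := V)
    (fun u v w => hG.reach_total) Finset.univ
  exact ⟨f, g, by simpa using hf, by simpa using hg,
    fun u v => h u (Finset.mem_univ _) v (Finset.mem_univ _)⟩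

/-! ### From superpatterns to universal point sets -/

theorem Fintype.exists_equiv_fin_lt_iff {α L : Type*} [Fintype α] [LinearOrder L] {k : ℕ}
    (hk : Fintype.card α = k) {f : α → L} (hf : Function.Injective f) :
    ∃ e : Fin k ≃ α, ∀ i j, i < j ↔ f (e i) < f (e j) := by
  let _ : LinearOrder α := LinearOrder.lift' f hf
  let e := Fintype.orderIsoFinOfCardEq α hk
  exact ⟨e.toEquiv, fun i j => (e.lt_iff_lt (x := i) (y := j)).symm⟩

theorem Fintype.exists_perm_of_injective {α L L' : Type*} [Fintype α] [LinearOrder L]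
    [LinearOrder L'] {k : ℕ} (hk : Fintype.card α = k) {f : α → L} (hf : Function.Injective f)
    {g : α → L'} (hg : Function.Injective g) :
    ∃ (σ : Equiv.Perm (Fin k)) (e : Fin k ≃ α), (∀ i j, i < j ↔ f (e i) < f (e j)) ∧
      ∀ i j, σ i < σ j ↔ g (e i) < g (e j) := by
  obtain ⟨e, he⟩ := Fintype.exists_equiv_fin_lt_iff hk hf
  obtain ⟨e', he'⟩ := Fintype.exists_equiv_fin_lt_iff hk hg
  exact ⟨e.trans e'.symm, e, he, fun i j => by simp [he']⟩

theorem permPlot_card {k : ℕ} (σ : Equiv.Perm (Fin k)) : (permPlot σ).card = k := by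
  rw [permPlot, Finset.card_image_of_injective, Finset.card_univ, Fintype.card_fin]
  intro i j h
  have := congrArg Prod.fst h
  exact Fin.ext (by exact_mod_cast add_right_cancel this)

/-- If the remaining elements are ordered like a superpattern, the plot of a permutation that
starts with its smallest element is universal. -/
theorem IsSuperpattern213.isUniversalForTrees {n k : ℕ} {μ : Equiv.Perm (Fin k)}
    (hμ : IsSuperpattern213 (n - 1) μ) :
    IsUniversalForTrees.{u} n (permPlot (prependMin μ)) := by
  classical
  intro V _ G hV hG
  obtain ⟨r, hr⟩ := hG.2.2
  obtain ⟨f, g, hf, hg, hfg⟩ := hG.exists_realizer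
  obtain ⟨π, e, he, hπ⟩ := Fintype.exists_perm_of_injective (α := {v : V // v ≠ r}) (k := n - 1)
    (by simp [Fintype.card_subtype_compl, hV]) (f := fun v => f v) (g := fun v => g v)
    (fun a b h => Subtype.ext (hf h)) (fun a b h => Subtype.ext (hg h))
  have hπ213 : Avoids213 π := by
    rintro ⟨l, hl⟩
    have l01 : l 0 < l 1 := l.lt_iff_lt.2 (by decide)
    have l12 : l 1 < l 2 := l.lt_iff_lt.2 (by decide)
    have h10 := (hπ _ _).1 ((hl 1 0).1 (by decide))
    have h02 := (hπ _ _).1 ((hl 0 2).1 (by decide))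
    rw [he] at l01 l12
    rcases hG.reach_total ((hfg _ _).2 ⟨(l01.trans l12).le, h02.le⟩)
      ((hfg _ _).2 ⟨l12.le, (h10.trans h02).le⟩) with h | h
    · exact absurd ((hfg _ _).1 h).2 (not_le.2 h10)
    · exact absurd ((hfg _ _).1 h).1 (not_le.2 l01)
  obtain ⟨l, hl⟩ := hμ π hπ213
  let idx : V → Fin (k + 1) := fun v => if h : v = r then 0 else (l (e.symm ⟨v, h⟩)).succ
  have idx_r : idx r = 0 := dif_pos rfl
  have idx_ne : ∀ v (h : v ≠ r), idx v = (l (e.symm ⟨v, h⟩)).succ := fun v h => dif_neg h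
  let p : V → ℝ × ℝ := fun v =>
    (((idx v : ℕ) : ℝ) + 1, ((prependMin μ (idx v) : ℕ) : ℝ) + 1)
  have hple : ∀ u v, p u ≤ p v ↔ idx u ≤ idx v ∧ prependMin μ (idx u) ≤ prependMin μ (idx v) := by
    intro u v
    simp only [p, Prod.mk_le_mk, add_le_add_iff_right, Nat.cast_le, Fin.val_fin_le]
  have hdom : ∀ u v, Relation.ReflTransGen G.Adj u v ↔ p u ≤ p v := by
    intro u v
    rw [hple]
    by_cases hu : u = r
    · subst hu
      simp [idx_r, prependMin_zero, hr v]
    by_cases hv : v = r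
    · subst hv
      rw [idx_r, idx_ne u hu]
      constructor
      · intro h
        exact absurd (hG.reach_antisymm h (hr u)) hu
      · intro h
        exact absurd h.1 (not_le.2 (Fin.succ_pos _))
    · rw [idx_ne u hu, idx_ne v hv, prependMin_succ, prependMin_succ, Fin.succ_le_succ_iff,
        Fin.succ_le_succ_iff, l.le_iff_le, hfg u v, ← not_lt, ← not_lt, ← not_lt (a := e.symm _),
        ← not_lt (a := μ _), ← hl, he, hπ]
      simp
  have hinj : Function.Injective p := by
    intro u v h
    exact hG.reach_antisymm ((hdom _ _).2 h.le) ((hdom _ _).2 h.ge)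
  have hdraw : IsDominanceDrawing G p := ⟨hinj, hdom⟩
  refine ⟨p, fun v => ?_, hdraw, hdraw.isPlanarDrawing hG⟩
  exact Finset.mem_image.2 ⟨idx v, Finset.mem_univ _, rfl⟩

/-! ### Drawing 213-avoiding permutations in nested rows -/

/-- Nested rows: `n` points in row `1`, a point in row `0` under the last of them, and above
them, two rows higher, the same for `n - 2`. -/
def nestedRows : ℕ → Finset (ℕ × ℕ)
  | 0 => ∅
  | n + 1 => (Finset.range (n + 1)).image (fun c => (c, 1)) ∪ {(n, 0)} ∪
      (nestedRows (n - 1)).image (fun p => (p.1, p.2 + 2))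

theorem four_mul_card_nestedRows_le (n : ℕ) : 4 * (nestedRows n).card ≤ n * n + 8 * n := by
  induction n using Nat.strong_induction_on with
  | _ n ih =>
    match n with
    | 0 => simp [nestedRows]
    | 1 => simp [nestedRows]
    | n + 2 =>
      have h := ih n (by omega)
      have h1 : (nestedRows (n + 2)).card ≤ (n + 2) + 1 + (nestedRows n).card := by
        rw [nestedRows]
        refine (Finset.card_union_le _ _).trans (add_le_add ((Finset.card_union_le _ _).trans
          (add_le_add ?_ ?_)) Finset.card_image_le)
        · exact Finset.card_image_le.trans (by simp)
        · simp
      nlinarith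

/-- `φ` draws the elements of `A`, which are listed by `col` from left to right and by `val` from
bottom to top, with each element in a column that is not right of its own one and not left of the
column of some element below or equal to it. -/
structure IsColumnDrawing {ι : Type*} (A : Finset ι) (col val : ι → ℕ) (φ : ι → ℕ × ℕ) : Prop where
  lt_of_col_lt : ∀ a ∈ A, ∀ b ∈ A, col a < col b →
    (φ a).1 < (φ b).1 ∨ (φ a).1 = (φ b).1 ∧ (φ a).2 < (φ b).2
  lt_of_val_lt : ∀ a ∈ A, ∀ b ∈ A, val a < val b →
    (φ a).2 < (φ b).2 ∨ (φ a).2 = (φ b).2 ∧ (φ a).1 < (φ b).1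
  fst_le : ∀ a ∈ A, (φ a).1 ≤ col a
  le_fst : ∀ a ∈ A, ∃ r ∈ A, col r ≤ col a ∧ val r ≤ val a ∧ col r ≤ (φ a).1

/-- No three elements of `A`, listed by `col`, have their values `val` ordered like `213`. -/
def No213 {ι : Type*} (A : Finset ι) (col val : ι → ℕ) : Prop :=
  ∀ a ∈ A, ∀ b ∈ A, ∀ c ∈ A, col a < col b → col b < col c → val b < val a → ¬ val a < val c

theorem No213.mono {ι : Type*} {A B : Finset ι} {col val : ι → ℕ} (h : No213 A col val)
    (hB : B ⊆ A) : No213 B col val :=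
  fun a ha b hb c hc => h a (hB ha) b (hB hb) c (hB hc)

/-- The elements that are at most as high as the last one form an increasing sequence; they are
drawn in row `1`, and the others above this row. -/
theorem exists_isColumnDrawing_row {ι : Type*} {n : ℕ}
    (ih : ∀ (A : Finset ι) (col val : ι → ℕ), Set.InjOn col A → Set.InjOn val A →
      (∀ a ∈ A, col a < n - 1) → No213 A col val →
      ∃ φ, IsColumnDrawing A col val φ ∧ ∀ a ∈ A, φ a ∈ nestedRows (n - 1))
    {A : Finset ι} {col val : ι → ℕ} (hcol : Set.InjOn col A) (hval : Set.InjOn val A)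
    (h213 : No213 A col val) {z : ι} (hz : z ∈ A)
    (hlast : ∀ a ∈ A, col a ≤ col z) (hn : col z ≤ n)
    (hroom : col z < n ∨ ∃ a ∈ A, val a < val z) :
    ∃ φ, IsColumnDrawing A col val φ ∧ (∀ a ∈ A, φ a ∈ nestedRows (n + 1)) ∧
      ∀ a ∈ A, 1 ≤ (φ a).2 := by
  classical
  obtain ⟨w, hwA, hw⟩ := A.exists_min_image val ⟨z, hz⟩
  have hwz : val w ≤ val z := hw z hz
  have hlt : ∀ a ∈ A, a ≠ z → col a < col z := fun a ha h =>
    lt_of_le_of_ne (hlast a ha) fun e => h (hcol ha hz e)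
  -- A descent `b`, `a` at or below the height of `z` would form 213 with `z`.
  have chain : ∀ a ∈ A, ∀ b ∈ A, val b ≤ val z → val a < val b → col a < col b := by
    intro a ha b hb hbz hab
    by_contra! hba
    have h1 : col b < col a := lt_of_le_of_ne hba fun e => by
      rw [hcol hb ha e] at hab; exact lt_irrefl _ hab
    have h2 : col a < col z := hlt a ha (by rintro rfl; omega)
    refine h213 b hb a ha z hz h1 h2 hab (lt_of_le_of_ne hbz fun e => ?_)
    rw [hval hb hz e] at h1
    omega
  have hwle : ∀ a ∈ A, val a ≤ val z → col w ≤ col a := by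
    intro a ha haz
    rcases (hw a ha).eq_or_lt with h | h
    · rw [hval hwA ha h]
    · exact (chain w hwA a ha haz h).le
  have hne : ∀ a ∈ A, ∀ b ∈ A, val a ≤ val z → val z < val b → col a ≠ col b := by
    intro a ha b hb h1 h2 e
    rw [hcol ha hb e] at h1
    omega
  -- Otherwise `r`, `a`, `b` form 213.
  have after : ∀ a ∈ A, ∀ b ∈ A, ∀ r ∈ A, val a ≤ val z → val z < val r → col r ≤ col b →
      val r ≤ val b → col a < col b → col a < col r := by
    intro a ha b hb r hr haz hrz hrb hrb' hab
    by_contra! hra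
    have h1 : col r < col a := lt_of_le_of_ne hra (hne a ha r hr haz hrz).symm
    refine h213 r hr a ha b hb h1 hab (by omega) (lt_of_le_of_ne hrb' fun e => ?_)
    rw [hval hr hb e] at h1
    omega
  have hw0 : ∀ a ∈ A, val z < val a → col w ≠ col a := fun a ha => hne w hwA a ha hwz
  -- No upper element is in the column of `w`, so that column is deleted.
  let col' : ι → ℕ := fun a => if col a < col w then col a else col a - 1
  have col'_def : ∀ a, col a < col w ∧ col' a = col a ∨ col w ≤ col a ∧ col' a = col a - 1 := by
    intro a
    by_cases h : col a < col w
    · exact Or.inl ⟨h, if_pos h⟩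
    · exact Or.inr ⟨not_lt.1 h, if_neg h⟩
  have hB : ∀ a, a ∈ A.filter (val z < val ·) ↔ a ∈ A ∧ val z < val a := fun a => by simp
  have col'_lt : ∀ a ∈ A, ∀ b ∈ A, val z < val a → val z < val b →
      (col' a < col' b ↔ col a < col b) := by
    intro a ha b hb h1 h2
    have := hw0 a ha h1
    have := hw0 b hb h2
    have := col'_def a
    have := col'_def b
    omega
  obtain ⟨ψ, hψ, hψmem⟩ := ih (A.filter (val z < val ·)) col' val
    (by
      intro a ha b hb hab
      rw [Finset.mem_coe, hB] at ha hb
      refine hcol ha.1 hb.1 ?_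
      have h1 := col'_lt a ha.1 b hb.1 ha.2 hb.2
      have h2 := col'_lt b hb.1 a ha.1 hb.2 ha.2
      omega)
    (hval.mono fun a ha => Finset.mem_of_mem_filter a ha)
    (by
      intro a ha
      rw [hB] at ha
      have h1 := hlt a ha.1 (by rintro rfl; omega)
      have h2 := col'_def a
      have h3 := hw0 a ha.1 ha.2
      -- Two columns must be saved: either the last column `n` is already empty, or `w` and `z`
      -- occupy distinct columns.
      rcases hroom with h | ⟨b, hb, hbz⟩
      · omega
      · have := chain w hwA z hz le_rfl ((hw b hb).trans_lt hbz)
        omega)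
    (by
      intro a ha b hb c hc h1 h2
      rw [hB] at ha hb hc
      rw [col'_lt a ha.1 b hb.1 ha.2 hb.2] at h1
      rw [col'_lt b hb.1 c hc.1 hb.2 hc.2] at h2
      exact h213 a ha.1 b hb.1 c hc.1 h1 h2)
  let φ : ι → ℕ × ℕ := fun a => if val a ≤ val z then (col a, 1) else ((ψ a).1, (ψ a).2 + 2)
  have φ1 : ∀ a, val a ≤ val z → φ a = (col a, 1) := fun a h => if_pos h
  have φ2 : ∀ a, val z < val a → φ a = ((ψ a).1, (ψ a).2 + 2) := fun a h => if_neg (not_le.2 h)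
  -- The witness `r` for `b` is right of `a`, so even after its shift by one it bounds the column of
  -- `b` from below by that of `a`. Equality is allowed, since row 1 is below the shifted drawing.
  have low : ∀ a ∈ A, ∀ b ∈ A, val a ≤ val z → val z < val b → col a < col b →
      col a ≤ (ψ b).1 := by
    intro a ha b hb haz hbz hab
    obtain ⟨r, hr, hrb, hrb', hr'⟩ := hψ.le_fst b ((hB b).2 ⟨hb, hbz⟩)
    rw [hB] at hr
    have h1 : col r ≤ col b := by
      have := (col'_lt b hb r hr.1 hbz hr.2)
      omega
    have h2 := after a ha b hb r hr.1 haz hr.2 h1 hrb' hab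
    have h3 := hwle a ha haz
    have h4 := col'_def r
    omega
  refine ⟨φ, ⟨?_, ?_, ?_, ?_⟩, ?_, ?_⟩
  · intro a ha b hb hab
    rcases le_or_gt (val a) (val z) with h1 | h1 <;> rcases le_or_gt (val b) (val z) with h2 | h2
    · rw [φ1 a h1, φ1 b h2]
      exact Or.inl hab
    · have := low a ha b hb h1 h2 hab
      rw [φ1 a h1, φ2 b h2]
      simp only
      omega
    · have := hψ.fst_le a ((hB a).2 ⟨ha, h1⟩)
      have := col'_def a
      rw [φ2 a h1, φ1 b h2]
      simp only
      omega
    · have := hψ.lt_of_col_lt a ((hB a).2 ⟨ha, h1⟩) b ((hB b).2 ⟨hb, h2⟩)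
        ((col'_lt a ha b hb h1 h2).2 hab)
      rw [φ2 a h1, φ2 b h2]
      simp only
      omega
  · intro a ha b hb hab
    rcases le_or_gt (val a) (val z) with h1 | h1 <;> rcases le_or_gt (val b) (val z) with h2 | h2
    · rw [φ1 a h1, φ1 b h2]
      exact Or.inr ⟨rfl, chain a ha b hb h2 hab⟩
    · rw [φ1 a h1, φ2 b h2]
      simp only
      omega
    · omega
    · have := hψ.lt_of_val_lt a ((hB a).2 ⟨ha, h1⟩) b ((hB b).2 ⟨hb, h2⟩) hab
      rw [φ2 a h1, φ2 b h2]
      simp only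
      omega
  · intro a ha
    rcases le_or_gt (val a) (val z) with h1 | h1
    · rw [φ1 a h1]
    · have := hψ.fst_le a ((hB a).2 ⟨ha, h1⟩)
      have := col'_def a
      rw [φ2 a h1]
      simp only
      omega
  · intro a ha
    rcases le_or_gt (val a) (val z) with h1 | h1
    · exact ⟨a, ha, le_rfl, le_rfl, by rw [φ1 a h1]⟩
    · rcases lt_or_ge (col a) (col w) with h2 | h2
      · obtain ⟨r, hr, hra, hra', hr'⟩ := hψ.le_fst a ((hB a).2 ⟨ha, h1⟩)
        rw [hB] at hr
        have h3 := col'_lt a ha r hr.1 h1 hr.2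
        have h4 := col'_def r
        refine ⟨r, hr.1, by omega, hra', ?_⟩
        rw [φ2 a h1]
        simp only
        omega
      · have h3 := lt_of_le_of_ne h2 (hw0 a ha h1)
        refine ⟨w, hwA, h2, hw a ha, ?_⟩
        rw [φ2 a h1]
        exact low w hwA a ha hwz h1 h3
  · intro a ha
    rw [nestedRows]
    rcases le_or_gt (val a) (val z) with h1 | h1
    · have := hlast a ha
      rw [φ1 a h1]
      simp
      omega
    · have := hψmem a ((hB a).2 ⟨ha, h1⟩)
      rw [φ2 a h1]
      exact Finset.mem_union_right _ (Finset.mem_image.2 ⟨ψ a, this, rfl⟩)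
  · intro a ha
    rcases le_or_gt (val a) (val z) with h1 | h1
    · rw [φ1 a h1]
    · rw [φ2 a h1]
      simp only
      omega

/-- One row is peeled off at a time. If the last element is in the last column and is also the
lowest, its row would save only one column; it goes to the extra point in row 0, and the row is
formed from the remaining elements, which leave the last column empty. -/
theorem exists_isColumnDrawing {ι : Type*} (n : ℕ) : ∀ (A : Finset ι) (col val : ι → ℕ),
    Set.InjOn col A → Set.InjOn val A → (∀ a ∈ A, col a < n) → No213 A col val →
    ∃ φ, IsColumnDrawing A col val φ ∧ ∀ a ∈ A, φ a ∈ nestedRows n := by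
  classical
  induction n using Nat.strong_induction_on with
  | _ n ih =>
    intro A col val hcol hval hlt h213
    rcases A.eq_empty_or_nonempty with rfl | hA
    · exact ⟨fun _ => 0, ⟨by simp, by simp, by simp, by simp⟩, by simp⟩
    obtain ⟨z, hz, hlast⟩ := A.exists_max_image col hA
    obtain ⟨n, rfl⟩ : ∃ m, n = m + 1 := ⟨n - 1, by have := hlt z hz; omega⟩
    have ih' := ih (n - 1) (by omega)
    by_cases hroom : col z < n ∨ ∃ a ∈ A, val a < val z
    · obtain ⟨φ, h1, h2, -⟩ := exists_isColumnDrawing_row ih' hcol hval h213 hz hlast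
        (Nat.le_of_lt_succ (hlt z hz)) hroom
      exact ⟨φ, h1, h2⟩
    push Not at hroom
    obtain ⟨hzn, hzmin⟩ := hroom
    have hzn : col z = n := by have := hlt z hz; omega
    have hBA : A.erase z ⊆ A := Finset.erase_subset _ _
    have hBlt : ∀ a ∈ A.erase z, col a < n := fun a ha =>
      hzn ▸ lt_of_le_of_ne (hlast a (hBA ha)) fun e =>
        (Finset.ne_of_mem_erase ha) (hcol (hBA ha) hz e)
    have hB : ∃ φ, IsColumnDrawing (A.erase z) col val φ ∧
        (∀ a ∈ A.erase z, φ a ∈ nestedRows (n + 1)) ∧ ∀ a ∈ A.erase z, 1 ≤ (φ a).2 := by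
      rcases (A.erase z).eq_empty_or_nonempty with h | h
      · rw [h]
        exact ⟨fun _ => 0, ⟨by simp, by simp, by simp, by simp⟩, by simp, by simp⟩
      · obtain ⟨y, hy, hylast⟩ := (A.erase z).exists_max_image col h
        exact exists_isColumnDrawing_row ih' (hcol.mono hBA) (hval.mono hBA) (h213.mono hBA) hy
          hylast (hBlt y hy).le (Or.inl (hBlt y hy))
    obtain ⟨φ, hφ, hmem, hpos⟩ := hB
    let χ : ι → ℕ × ℕ := fun a => if a = z then (n, 0) else φ a
    have χz : χ z = (n, 0) := if_pos rfl
    have χ' : ∀ a ∈ A, a ≠ z → χ a = φ a ∧ a ∈ A.erase z := fun a ha h =>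
      ⟨if_neg h, Finset.mem_erase.2 ⟨h, ha⟩⟩
    refine ⟨χ, ⟨?_, ?_, ?_, ?_⟩, ?_⟩
    · intro a ha b hb hab
      have haz : a ≠ z := by rintro rfl; have := hlast b hb; omega
      obtain ⟨e1, ha'⟩ := χ' a ha haz
      by_cases hbz : b = z
      · subst hbz
        rw [e1, χz]
        exact Or.inl ((hφ.fst_le a ha').trans_lt (hBlt a ha'))
      · obtain ⟨e2, hb'⟩ := χ' b hb hbz
        rw [e1, e2]
        exact hφ.lt_of_col_lt a ha' b hb' hab
    · intro a ha b hb hab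
      have hbz : b ≠ z := by rintro rfl; have := hzmin a ha; omega
      obtain ⟨e2, hb'⟩ := χ' b hb hbz
      by_cases haz : a = z
      · subst haz
        rw [e2, χz]
        exact Or.inl (hpos b hb')
      · obtain ⟨e1, ha'⟩ := χ' a ha haz
        rw [e1, e2]
        exact hφ.lt_of_val_lt a ha' b hb' hab
    · intro a ha
      by_cases haz : a = z
      · subst haz
        rw [χz, hzn]
      · obtain ⟨e1, ha'⟩ := χ' a ha haz
        rw [e1]
        exact hφ.fst_le a ha'
    · intro a ha
      by_cases haz : a = z
      · subst haz
        exact ⟨a, ha, le_rfl, le_rfl, by rw [χz, hzn]⟩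
      · obtain ⟨e1, ha'⟩ := χ' a ha haz
        obtain ⟨r, hr, h⟩ := hφ.le_fst a ha'
        rw [e1]
        exact ⟨r, hBA hr, h⟩
    · intro a ha
      by_cases haz : a = z
      · subst haz
        rw [χz, nestedRows]
        simp
      · obtain ⟨e1, ha'⟩ := χ' a ha haz
        rw [e1]
        exact hmem a ha'

/-! ### Superpatterns of the required size -/

/-- A set of points that contains the nested rows gives a superpattern, if points with equal
first coordinates are ordered by the second one and conversely. -/
theorem exists_isSuperpattern213 {m k : ℕ} {P : Finset (ℕ × ℕ)} (hP : nestedRows m ⊆ P)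
    (hk : P.card = k) : ∃ μ : Equiv.Perm (Fin k), IsSuperpattern213 m μ := by
  obtain ⟨μ, e, he, hμ⟩ := Fintype.exists_perm_of_injective (α := P) (k := k) (by simpa using hk)
    (f := fun p => toLex p.1) (g := fun p => toLex p.1.swap)
    (fun a b h => Subtype.ext (toLex.injective h))
    (fun a b h => Subtype.ext (Prod.swap_injective (toLex.injective h)))
  refine ⟨μ, fun π hπ => ?_⟩
  obtain ⟨φ, hφ, hmem⟩ := exists_isColumnDrawing m (Finset.univ : Finset (Fin m))
    (fun i => i) (fun i => π i) (fun a _ b _ h => Fin.ext h)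
    (fun a _ b _ h => π.injective (Fin.ext h)) (fun a _ => a.2) (by
      intro a _ b _ c _ hab hbc hba hac
      have hab : a < b := hab
      have hbc : b < c := hbc
      refine hπ ⟨OrderEmbedding.ofStrictMono ![a, b, c] ?_, ?_⟩
      · intro i j hij
        fin_cases i <;> fin_cases j <;> simp_all [hab.trans hbc]
      · have h1 : π b < π a := hba
        have h2 : π a < π c := hac
        have h3 := h1.trans h2
        intro i j
        change perm213 i < perm213 j ↔ π (![a, b, c] i) < π (![a, b, c] j)
        fin_cases i <;> fin_cases j <;>
          simp [perm213, Equiv.swap_apply_def, h1, h2, h3, h1.le, h2.le, h3.le])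
  let l : Fin m → Fin k := fun i => e.symm ⟨φ i, hP (hmem i (Finset.mem_univ i))⟩
  have hl : StrictMono l := by
    intro i j hij
    rw [he, Prod.Lex.toLex_lt_toLex]
    simpa [l] using hφ.lt_of_col_lt i (Finset.mem_univ i) j (Finset.mem_univ j) hij
  have hlμ : ∀ i j, π i < π j → μ (l i) < μ (l j) := by
    intro i j hij
    rw [hμ, Prod.Lex.toLex_lt_toLex]
    simpa [l] using hφ.lt_of_val_lt i (Finset.mem_univ i) j (Finset.mem_univ j) hij
  refine ⟨OrderEmbedding.ofStrictMono l hl, fun i j => ⟨hlμ i j, fun h => ?_⟩⟩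
  by_contra! hc
  rcases hc.eq_or_lt with h' | h'
  · rw [π.injective h'] at h
    exact lt_irrefl _ h
  · exact lt_asymm h (hlμ j i h')

theorem exists_isSuperpattern213_of_card_eq {n : ℕ} :
    ∃ μ : Equiv.Perm (Fin (n ^ 2 / 4 + 2 * n)), IsSuperpattern213 (n - 1) μ := by
  -- Any superset of the nested rows works, so padding fixes the size exactly; this also yields the
  -- lower bound on the cardinality.
  obtain ⟨P, hP, hcard⟩ := Infinite.exists_superset_card_eq (nestedRows (n - 1))
    (n ^ 2 / 4 + 2 * n) (by
      have h := four_mul_card_nestedRows_le (n - 1)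
      have h2 : (n - 1) * (n - 1) ≤ n ^ 2 := by
        rw [pow_two]; exact Nat.mul_le_mul (Nat.sub_le _ _) (Nat.sub_le _ _)
      omega)
  exact exists_isSuperpattern213 hP hcard

theorem mainTheorem7 :
    (∀ (V : Type u) (G : Digraph V) (p : V → ℝ × ℝ) (n : ℕ) (σ : Equiv.Perm (Fin n)),
      IsRootedTree G → IsDominanceDrawing G p → IsPermOfDrawing p σ → Avoids213 σ) ∧
    ∃ U : ℕ → Finset (ℝ × ℝ),
      (∀ n : ℕ, 1 ≤ n → IsUniversalForTrees.{u} n (U n)) ∧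
      (∀ n : ℕ, 1 ≤ n → ∃ (k : ℕ) (μ : Equiv.Perm (Fin k)),
        IsSuperpattern213 (n - 1) μ ∧ U n = permPlot (prependMin μ)) ∧
      ∃ c C : ℝ, 0 < c ∧ 0 < C ∧ ∀ n : ℕ, 1 ≤ n →
        (n : ℝ) ^ 2 / 4 + c * n ≤ ((U n).card : ℝ) ∧
        ((U n).card : ℝ) ≤ (n : ℝ) ^ 2 / 4 + C * n := by
  refine ⟨fun V G p n σ hG hp hσ => hp.avoids213 hG hσ, ?_⟩
  choose μ hμ using fun n => exists_isSuperpattern213_of_card_eq (n := n)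
  refine ⟨fun n => permPlot (prependMin (μ n)), fun n _ => (hμ n).isUniversalForTrees,
    -- The size is ⌊n²/4⌋ + 2n + 1; the extra 1 absorbs the rounding loss of at most 3/4 and is
    -- itself at most n.
    fun n _ => ⟨_, μ n, hμ n, rfl⟩, 1, 3, by norm_num, by norm_num, fun n hn => ?_⟩
  rw [permPlot_card]
  have hn' : (1 : ℝ) ≤ n := by exact_mod_cast hn
  have h1 : ((4 * (n ^ 2 / 4) : ℕ) : ℝ) ≤ ((n ^ 2 : ℕ) : ℝ) := by
    exact_mod_cast Nat.mul_div_le (n ^ 2) 4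
  have h2 : ((n ^ 2 : ℕ) : ℝ) ≤ ((4 * (n ^ 2 / 4) + 3 : ℕ) : ℝ) := by
    exact_mod_cast (by omega : n ^ 2 ≤ 4 * (n ^ 2 / 4) + 3)
  push_cast at h1 h2 ⊢
  constructor <;> linarith
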